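/- Let $S\subset\mathbb{R}^2$ be the Sierpinski gasket, i.e. the unique non-empty compact set with $S=f_0(S)\cup f_1(S)\cup f_2(S)$, where $f_0(x,y)=(\tfrac12x,\tfrac12y)$, $f_1(x,y)=(\tfrac12x+\tfrac12,\tfrac12y)$, $f_2(x,y)=(\tfrac12x+\tfrac14,\tfrac12y+\tfrac{\sqrt3}{4})$. For $a_1,\dots,a_k\in\{0,1,2\}$ put $S_{a_1\cdots a_k}=f_{a_1}\circ\cdots\circ f_{a_k}(S)$; a sequence $(a_i)_{i\ge1}$ in $\{0,1,2\}$ is a code of the point $a\in S$ if $a\in S_{a_1\cdots a_k}$ for every $k\ge0$ (for $k=0$ this set is $S$). Every point of $S$ has a code, and there is a function $d\colon S\times S\to\mathbb{R}$ with $d(a,a)=0$ for all $a\in S$ such that, whenever $(a_i)$ and $(b_i)$ are codes of points $a,b\in S$ with $a_i=b_i$ for $i<k$ and $a_k\ne b_k$, $$d(a,b)=\min\left\{\sum_{i=k+1}^{\infty}\frac{\alpha_i+\beta_i}{2^i},\ \frac1{2^k}+\sum_{i=k+1}^{\infty}\frac{\gamma_i+\delta_i}{2^i}\right\},$$ where $\alpha_i=0$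 if $a_i=b_k$ and $\alpha_i=1$ otherwise; $\beta_i=0$ if $b_i=a_k$ and $\beta_i=1$ otherwise; $\gamma_i=0$ if $a_i\notin\{a_k,b_k\}$ and $\gamma_i=1$ otherwise; $\delta_i=0$ if $b_i\notin\{a_k,b_k\}$ and $\delta_i=1$ otherwise. This function $d$ is a strictly intrinsic metric on $S$. That is: $d$ is a metric on $S$; for all $a,b\in S$, $d(a,b)$ is the infimum of the Euclidean lengths of the rectifiable curves in $S$ joining $a$ and $b$, and this infimum is attained; and likewise, for all $a,b\in S$, $d(a,b)$ is the minimum of the $d$-lengths of the $d$-continuous, $d$-rectifiable curves in $S$ joining $a$ and $b$. -/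

import Mathlib

open scoped NNReal ENNReal

/-! ### The Sierpinski gasket as the attractor of an iterated function system -/

/-- The three similarities `f₀, f₁, f₂` of the Euclidean plane with ratio `1/2`. -/
noncomputable def gasketMap : Fin 3 → EuclideanSpace ℝ (Fin 2) → EuclideanSpace ℝ (Fin 2)
  | 0 => fun p => !₂[1 / 2 * p 0, 1 / 2 * p 1]
  | 1 => fun p => !₂[1 / 2 * p 0 + 1 / 2, 1 / 2 * p 1]
  | 2 => fun p => !₂[1 / 2 * p 0 + 1 / 4, 1 / 2 * p 1 + √3 / 4]

theorem gasketMap_dist (i : Fin 3) (p q : EuclideanSpace ℝ (Fin 2)) :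
    dist (gasketMap i p) (gasketMap i q) = 1 / 2 * dist p q := by
  have key : gasketMap i p - gasketMap i q = (1 / 2 : ℝ) • (p - q) := by
    ext j
    fin_cases i <;> fin_cases j <;> simp [gasketMap] <;> ring
  rw [dist_eq_norm, dist_eq_norm, key, norm_smul]
  norm_num

theorem gasketMap_lipschitz (i : Fin 3) : LipschitzWith (1 / 2) (gasketMap i) :=
  LipschitzWith.of_dist_le_mul fun p q => by
    rw [gasketMap_dist]
    simp

/-- The Hutchinson operator `K ↦ f₀(K) ∪ f₁(K) ∪ f₂(K)` on non-empty compact sets. -/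
noncomputable def hutchinson
    (K : TopologicalSpace.NonemptyCompacts (EuclideanSpace ℝ (Fin 2))) :
    TopologicalSpace.NonemptyCompacts (EuclideanSpace ℝ (Fin 2)) where
  carrier := ⋃ i : Fin 3, gasketMap i '' (K : Set (EuclideanSpace ℝ (Fin 2)))
  isCompact' := isCompact_iUnion fun i => K.isCompact.image (gasketMap_lipschitz i).continuous
  nonempty' := Set.nonempty_iUnion.2 ⟨0, K.nonempty.image _⟩

theorem hutchinson_contracting : ContractingWith (1 / 2) hutchinson := by
  refine ⟨by rw [← NNReal.coe_lt_coe]; norm_num, fun K L => ?_⟩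
  refine Metric.hausdorffEDist_iUnion_le.trans (iSup_le fun i => ?_)
  refine Metric.hausdorffEDist_le_of_mem_edist ?_ ?_
  · rintro _ ⟨x, hx, rfl⟩
    obtain ⟨y, hy, hxy⟩ :=
      L.isCompact.exists_infEDist_eq_edist L.nonempty x
    refine ⟨_, ⟨y, hy, rfl⟩, (gasketMap_lipschitz i x y).trans ?_⟩
    rw [← hxy]
    gcongr
    exact Metric.infEDist_le_hausdorffEDist_of_mem hx
  · rintro _ ⟨x, hx, rfl⟩
    obtain ⟨y, hy, hxy⟩ :=
      K.isCompact.exists_infEDist_eq_edist K.nonempty x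
    refine ⟨_, ⟨y, hy, rfl⟩, (gasketMap_lipschitz i x y).trans ?_⟩
    rw [← hxy, edist_comm K L]
    gcongr
    exact Metric.infEDist_le_hausdorffEDist_of_mem hx

/-- The Sierpinski gasket `S`: the unique non-empty compact subset of the plane
with `S = f₀(S) ∪ f₁(S) ∪ f₂(S)`. -/
noncomputable def gasket : Set (EuclideanSpace ℝ (Fin 2)) :=
  haveI : Nonempty (TopologicalSpace.NonemptyCompacts (EuclideanSpace ℝ (Fin 2))) := ⟨{0}⟩
  (ContractingWith.fixedPoint hutchinson hutchinson_contracting :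
    TopologicalSpace.NonemptyCompacts (EuclideanSpace ℝ (Fin 2)))

/-- `gasket` is the attractor of the iterated function system. -/
theorem isAttractor_iff_eq_gasket (K : Set (EuclideanSpace ℝ (Fin 2))) :
    (IsCompact K ∧ K.Nonempty ∧ K = ⋃ i : Fin 3, gasketMap i '' K) ↔ K = gasket := by
  have : Nonempty (TopologicalSpace.NonemptyCompacts (EuclideanSpace ℝ (Fin 2))) := ⟨{0}⟩
  constructor
  · rintro ⟨hc, hn, hK⟩
    have : Function.IsFixedPt hutchinson ⟨⟨K, hc⟩, hn⟩ :=
      TopologicalSpace.NonemptyCompacts.ext hK.symm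
    exact congrArg (fun L : TopologicalSpace.NonemptyCompacts (EuclideanSpace ℝ (Fin 2)) =>
      (L : Set (EuclideanSpace ℝ (Fin 2)))) (hutchinson_contracting.fixedPoint_unique this)
  · rintro rfl
    refine ⟨TopologicalSpace.NonemptyCompacts.isCompact _,
      TopologicalSpace.NonemptyCompacts.nonempty _, ?_⟩
    exact (congrArg (fun L : TopologicalSpace.NonemptyCompacts (EuclideanSpace ℝ (Fin 2)) =>
      (L : Set (EuclideanSpace ℝ (Fin 2))))
        (hutchinson_contracting.fixedPoint_isFixedPt (f := hutchinson))).symm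

/-! ### Codes -/

/-- The small triangular piece `S_{w₁ w₂ … wₖ} = f_{w₁}(f_{w₂}(⋯ f_{wₖ}(S)))` of the gasket. -/
noncomputable def subTriangle : List (Fin 3) → Set (EuclideanSpace ℝ (Fin 2))
  | [] => gasket
  | i :: w => gasketMap i '' subTriangle w

/-- The sequence `a` is a code of `x`, that is `x ∈ ⋂ₖ S_{a₁ … aₖ}`. Sequences are indexed from
`0`, so that the `i`-th digit `aᵢ` of the code (`i = 1, 2, …`) is `a (i - 1)`. -/
def IsCode (a : ℕ → Fin 3) (x : gasket) : Prop :=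
  ∀ k : ℕ, (x : EuclideanSpace ℝ (Fin 2)) ∈ subTriangle (List.ofFn fun j : Fin k => a j)

/-- The codes `a` and `b` first differ at the digit with number `k ∈ {1, 2, …}`. -/
def FirstDifferAt (a b : ℕ → Fin 3) (k : ℕ) : Prop :=
  1 ≤ k ∧ (∀ i, 1 ≤ i → i < k → a (i - 1) = b (i - 1)) ∧ a (k - 1) ≠ b (k - 1)

/-- The explicit formula for the distance of two points whose codes `a` and `b` first differ at
the digit with number `k`. A sum over `i ≥ k + 1` is written as a sum over `j ≥ 0` with
`i = k + 1 + j`, so that `aᵢ = a (k + j)` and `bᵢ = b (k + j)`. -/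
noncomputable def codeDist (a b : ℕ → Fin 3) (k : ℕ) : ℝ :=
  let ak := a (k - 1)
  let bk := b (k - 1)
  let α : ℕ → ℝ := fun j => if a (k + j) = bk then 0 else 1
  let β : ℕ → ℝ := fun j => if b (k + j) = ak then 0 else 1
  let γ : ℕ → ℝ := fun j => if a (k + j) ≠ ak ∧ a (k + j) ≠ bk then 0 else 1
  let δ : ℕ → ℝ := fun j => if b (k + j) ≠ bk ∧ b (k + j) ≠ ak then 0 else 1
  min (∑' j : ℕ, (α j + β j) / 2 ^ (k + 1 + j))
    (1 / 2 ^ k + ∑' j : ℕ, (γ j + δ j) / 2 ^ (k + 1 + j))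

/-- `d` is the distance function on the gasket given by the explicit formula: it vanishes on the
diagonal, and its value at `(x, y)` is given by the formula for every choice of two different
codes of `x` and `y`. -/
def IsCodeDistance (d : gasket → gasket → ℝ) : Prop :=
  (∀ x, d x x = 0) ∧
    ∀ (x y : gasket) (a b : ℕ → Fin 3) (k : ℕ),
      IsCode a x → IsCode b y → FirstDifferAt a b k → d x y = codeDist a b k

/-! ### Lengths of curves and strictly intrinsic metrics -/

/-- The set of lengths of the rectifiable curves joining `x` and `y` in a metric space; the length
of a curve is its total variation. -/
noncomputable def rectifiableLengths {X : Type*} [MetricSpace X] (x y : X) : Set ℝ :=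
  {ℓ | ∃ c : Path x y, eVariationOn c Set.univ ≠ ⊤ ∧ (eVariationOn c Set.univ).toReal = ℓ}

/-- The lengths of the rectifiable curves that join `x` and `y` in the gasket with respect to
the Euclidean metric. -/
noncomputable def gasketCurveLengths (x y : gasket) : Set ℝ := rectifiableLengths x y

/-- A metric is strictly intrinsic if the distance of any two points is the infimum of the lengths
of the curves joining them, lengths being measured by this metric, and it is attained. -/
def IsStrictlyIntrinsic {X : Type*} (m : MetricSpace X) : Prop :=
  ∀ x y : X, IsLeast (rectifiableLengths x y) (dist x y)

/-!
The point of the gasket with code `a` has barycentric coordinates `bary a m = ∑ᵢ [aᵢ = m] / 2ⁱ`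
with respect to the three corners, and its distance to the corner `m` is `1 - bary a m`. Therefore
the explicit formula for two codes with different first digits `i` and `j` compares two routes
between the cells `i` and `j`: through their common corner, or across the third cell. This is
`routeLength`, an expression in the coordinates of the tails of the two codes. For equal first
digits the formula scales by `1 / 2`. These two rules (`codeMetric_of_ne`, `codeMetric_of_eq`)
determine the distance of codes, and most estimates for it follow by unfolding them `n` times,
with an error of at most `(1 / 2) ^ n`, from linear inequalities in barycentric coordinates.

* The distance of codes satisfies the triangle inequality (`codeMetric_triangle`), dominates the
  Euclidean distance (`dist_le_codeMetric`), and vanishes exactly for two codes of the same point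
  (`codeMetric_eq_zero_iff`). So it descends to a metric `gasketDist` on the gasket.
* Any two points are joined by a curve `γ` on `[0, gasketDist x y]` that is `1`-Lipschitz for
  `gasketDist` (`joinedByLipschitz`). Such a curve is concatenated from curves to corners of cells,
  whose codes are written down digit by digit (`codeTowardsCorner`). As `gasketDist` dominates the
  Euclidean distance, the length of `γ` in either metric is at most `gasketDist x y`.
* Every curve has Euclidean length at least the distance of its ends (`gasketDist_le_length`).
  Different cells of level `n` meet only in vertices, so by connectedness a curve stays in one cell
  between consecutive visits to different vertices of level `n`. These vertices are two corners of
  one cell, whose distance in the metric equals their Euclidean distance. Adding up, the length is at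
  least the distance up to an error `2 / 2ⁿ` for the two ends of the curve. For lengths measured by
  the metric itself the lower bound is the triangle inequality.
-/

theorem le_of_forall_le_add_half_pow {x y : ℝ} (h : ∀ n : ℕ, x ≤ y + (1 / 2) ^ n) : x ≤ y := by
  have h1 : Filter.Tendsto (fun n : ℕ => y + (1 / 2 : ℝ) ^ n) Filter.atTop (nhds (y + 0)) :=
    tendsto_const_nhds.add (tendsto_pow_atTop_nhds_zero_of_lt_one (by norm_num) (by norm_num))
  simpa using ge_of_tendsto' h1 h

/-! ### Barycentric coordinates of a code -/

/-- The code without its first `n` digits. -/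
def dropDigits (n : ℕ) (a : ℕ → Fin 3) : ℕ → Fin 3 := fun i => a (n + i)

/-- The barycentric coordinate with index `m`, with respect to the corners of the gasket, of the
point with code `a`. -/
noncomputable def bary (a : ℕ → Fin 3) (m : Fin 3) : ℝ :=
  ∑' i : ℕ, if a i = m then (1 / 2 : ℝ) ^ (i + 1) else 0

theorem summable_half_pow_succ : Summable fun i : ℕ => (1 / 2 : ℝ) ^ (i + 1) := by
  simpa [pow_succ] using (summable_geometric_two.mul_right (1 / 2 : ℝ))

theorem tsum_half_pow_succ : ∑' i : ℕ, (1 / 2 : ℝ) ^ (i + 1) = 1 := by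
  simp_rw [pow_succ]
  rw [tsum_mul_right, tsum_geometric_two]
  norm_num

theorem summable_bary (a : ℕ → Fin 3) (m : Fin 3) :
    Summable fun i : ℕ => if a i = m then (1 / 2 : ℝ) ^ (i + 1) else 0 :=
  summable_half_pow_succ.of_nonneg_of_le (fun i => by split_ifs <;> positivity)
    (fun i => by split_ifs <;> [exact le_rfl; positivity])

theorem bary_nonneg (a : ℕ → Fin 3) (m : Fin 3) : 0 ≤ bary a m :=
  tsum_nonneg fun i => by split_ifs <;> positivity

theorem bary_sum (a : ℕ → Fin 3) : bary a 0 + bary a 1 + bary a 2 = 1 := by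
  unfold bary
  rw [← (summable_bary a 0).tsum_add (summable_bary a 1),
    ← ((summable_bary a 0).add (summable_bary a 1)).tsum_add (summable_bary a 2)]
  refine Eq.trans ?_ tsum_half_pow_succ
  congr 1
  ext i
  generalize a i = m
  fin_cases m <;> simp

theorem bary_le_one (a : ℕ → Fin 3) (m : Fin 3) : bary a m ≤ 1 := by
  have h0 := bary_nonneg a 0
  have h1 := bary_nonneg a 1
  have h2 := bary_nonneg a 2
  have h := bary_sum a
  fin_cases m <;> simp <;> linarith

theorem bary_eq_half (a : ℕ → Fin 3) (m : Fin 3) :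
    bary a m = ((if a 0 = m then 1 else 0) + bary (dropDigits 1 a) m) / 2 := by
  unfold bary
  rw [(summable_bary a m).tsum_eq_zero_add, add_div, ← tsum_div_const]
  congr 1
  · split_ifs <;> norm_num
  · congr 1
    ext i
    rw [dropDigits, add_comm 1 i]
    split_ifs
    · rw [pow_succ _ (i + 1)]
      ring
    · simp

theorem bary_const (i m : Fin 3) : bary (fun _ => i) m = if i = m then 1 else 0 := by
  unfold bary
  split_ifs with h
  · exact tsum_half_pow_succ
  · exact tsum_zero

/-- A corner of the gasket has only one code. -/
theorem eq_const_of_bary_eq_one {a : ℕ → Fin 3} {m : Fin 3} (h : bary a m = 1) :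
    a = fun _ => m := by
  have key : ∀ (n : ℕ) (a : ℕ → Fin 3), bary a m = 1 → a n = m := by
    intro n
    induction n with
    | zero =>
      intro a h
      have h1 := bary_eq_half a m
      have h2 := bary_le_one (dropDigits 1 a) m
      by_contra hne
      rw [if_neg hne] at h1
      linarith
    | succ n ih =>
      intro a h
      have h1 := bary_eq_half a m
      have h2 := bary_le_one (dropDigits 1 a) m
      have := ih (dropDigits 1 a) (by split_ifs at h1 <;> linarith)
      rwa [dropDigits, add_comm] at this
  exact funext fun n => key n a h

/-! ### The distance of two codes -/

/-- The length of the shorter of the two routes between a point of the cell `i` and a point of the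
cell `j ≠ i`, where `x` and `y` are the barycentric coordinates of the two points relative to their
cells: either through the common corner of these cells, or across the third cell. -/
noncomputable def routeLength (i j : Fin 3) (x y : Fin 3 → ℝ) : ℝ :=
  min ((2 - x j - y i) / 2) ((1 + (x i + x j) + (y i + y j)) / 2)

/-- The sums in the explicit formula are barycentric coordinates of the tails of the codes. -/
theorem codeDist_succ (a b : ℕ → Fin 3) (n : ℕ) (hne : a n ≠ b n) :
    codeDist a b (n + 1) = (1 / 2) ^ n *
      routeLength (a n) (b n) (bary (dropDigits (n + 1) a)) (bary (dropDigits (n + 1) b)) := by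
  have hb : ∀ (c : ℕ → Fin 3) (m : Fin 3), HasSum (fun j : ℕ => (1 / 2 : ℝ) ^ (n + 1) *
      (if c (n + 1 + j) = m then (1 / 2 : ℝ) ^ (j + 1) else 0))
        ((1 / 2) ^ (n + 1) * bary (dropDigits (n + 1) c) m) :=
    fun c m => (summable_bary _ m).hasSum.mul_left _
  have hb1 : HasSum (fun j : ℕ => (1 / 2 : ℝ) ^ (n + 1) * (1 / 2 : ℝ) ^ (j + 1))
      ((1 / 2) ^ (n + 1) * 1) := by
    have := summable_half_pow_succ.hasSum.mul_left ((1 / 2 : ℝ) ^ (n + 1))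
    rwa [tsum_half_pow_succ] at this
  have hpow : ∀ (z : ℝ) (j : ℕ), z / 2 ^ (n + 1 + 1 + j) =
      (1 / 2 : ℝ) ^ (n + 1) * (z * (1 / 2 : ℝ) ^ (j + 1)) := by
    intro z j
    rw [show n + 1 + 1 + j = (n + 1) + (j + 1) by ring, pow_add]
    simp only [one_div, inv_pow]
    field_simp
  unfold codeDist routeLength
  simp only [Nat.add_sub_cancel]
  rw [mul_min_of_nonneg _ _ (by positivity)]
  congr 1
  · refine ((tsum_congr fun j => ?_).trans
      (((hb1.add hb1).sub (hb a (b n))).sub (hb b (a n))).tsum_eq).trans (by ring)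
    rw [hpow]
    split_ifs <;> ring
  · refine (congrArg _ ((tsum_congr fun j => ?_).trans
      ((((hb a (a n)).add (hb a (b n))).add (hb b (a n))).add (hb b (b n))).tsum_eq)).trans
      (by simp only [one_div, inv_pow]; field_simp; ring)
    rw [hpow]
    by_cases h1 : a (n + 1 + j) = a n <;> by_cases h2 : a (n + 1 + j) = b n <;>
      by_cases h3 : b (n + 1 + j) = a n <;> by_cases h4 : b (n + 1 + j) = b n <;>
      first
        | exact absurd (h1.symm.trans h2) hne
        | exact absurd (h3.symm.trans h4) hne
        | (simp [h1, h2, h3, h4, hne, hne.symm]; done)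
        | (simp [h1, h2, h3, h4, hne, hne.symm]; ring)

open scoped Classical in
/-- The distance of two codes: the explicit formula at their first difference. -/
noncomputable def codeMetric (a b : ℕ → Fin 3) : ℝ :=
  if a = b then 0 else codeDist a b (PiNat.firstDiff a b + 1)

theorem codeMetric_self (a : ℕ → Fin 3) : codeMetric a a = 0 := if_pos rfl

theorem codeMetric_eq_codeDist {a b : ℕ → Fin 3} {k : ℕ} (h : FirstDifferAt a b k) :
    codeMetric a b = codeDist a b k := by
  obtain ⟨h1, h2, h3⟩ := h
  have hne : a ≠ b := fun hab => h3 (by rw [hab])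
  rw [codeMetric, if_neg hne]
  congr 1
  rcases lt_trichotomy (PiNat.firstDiff a b) (k - 1) with h | h | h
  · exact absurd (h2 (PiNat.firstDiff a b + 1) (by omega) (by omega))
      (PiNat.apply_firstDiff_ne hne)
  · omega
  · exact absurd (PiNat.apply_eq_of_lt_firstDiff h) h3

theorem codeMetric_of_ne {a b : ℕ → Fin 3} (h : a 0 ≠ b 0) : codeMetric a b =
    routeLength (a 0) (b 0) (bary (dropDigits 1 a)) (bary (dropDigits 1 b)) := by
  rw [codeMetric_eq_codeDist (k := 0 + 1) ⟨le_rfl, fun i _ _ => by omega, h⟩,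
    codeDist_succ a b 0 h]
  simp

theorem codeMetric_of_eq {a b : ℕ → Fin 3} (h : a 0 = b 0) :
    codeMetric a b = codeMetric (dropDigits 1 a) (dropDigits 1 b) / 2 := by
  by_cases hab : a = b
  · rw [hab, codeMetric_self, codeMetric_self, zero_div]
  set n := PiNat.firstDiff a b with hn
  have h1 : a n ≠ b n := PiNat.apply_firstDiff_ne hab
  obtain ⟨m, hm⟩ : ∃ m, n = m + 1 := Nat.exists_eq_succ_of_ne_zero fun h0 => h1 (by rwa [h0])
  have h2 : FirstDifferAt (dropDigits 1 a) (dropDigits 1 b) (m + 1) := by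
    refine ⟨by omega, fun i hi1 hi2 =>
      show a (1 + (i - 1)) = b (1 + (i - 1)) from PiNat.apply_eq_of_lt_firstDiff (by omega), ?_⟩
    simpa [dropDigits, add_comm, hm] using h1
  have h3 := h2.2.2
  simp only [Nat.add_sub_cancel] at h3
  have hd : ∀ c : ℕ → Fin 3, dropDigits (m + 1) (dropDigits 1 c) = dropDigits (m + 1 + 1) c := by
    intro c
    ext i
    simp only [dropDigits]
    congr 2
    ring
  have hd' : ∀ c : ℕ → Fin 3, dropDigits 1 c m = c (m + 1) := fun c => by
    rw [dropDigits, add_comm]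
  rw [codeMetric_eq_codeDist h2, codeMetric, if_neg hab, ← hn, codeDist_succ a b n h1,
    codeDist_succ _ _ m h3, hm, hd, hd, hd', hd', pow_succ]
  ring

/-- The barycentric coordinates of a code form a point of the standard simplex. -/
theorem bary_mem_stdSimplex (a : ℕ → Fin 3) : bary a ∈ stdSimplex ℝ (Fin 3) :=
  ⟨bary_nonneg a, by rw [Fin.sum_univ_three, bary_sum]⟩

theorem routeLength_comm (i j : Fin 3) (x y : Fin 3 → ℝ) :
    routeLength i j x y = routeLength j i y x := by
  unfold routeLength
  congr 1 <;> ring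

theorem codeMetric_comm (a b : ℕ → Fin 3) : codeMetric a b = codeMetric b a := by
  by_cases hab : a = b
  · rw [hab]
  · have h := PiNat.apply_firstDiff_ne hab
    rw [codeMetric, codeMetric, if_neg hab, if_neg (Ne.symm hab), PiNat.firstDiff_comm b a,
      codeDist_succ _ _ _ h, codeDist_succ _ _ _ h.symm, routeLength_comm]

theorem routeLength_nonneg {i j : Fin 3} {x y : Fin 3 → ℝ}
    (hx : x ∈ stdSimplex ℝ (Fin 3)) (hy : y ∈ stdSimplex ℝ (Fin 3)) :
    0 ≤ routeLength i j x y := by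
  have := hx.1 i
  have := hx.1 j
  have := hy.1 i
  have := hy.1 j
  have := (mem_Icc_of_mem_stdSimplex hx j).2
  have := (mem_Icc_of_mem_stdSimplex hy i).2
  exact le_min (by linarith) (by linarith)

theorem routeLength_le_one {i j : Fin 3} {x y : Fin 3 → ℝ}
    (hx : x ∈ stdSimplex ℝ (Fin 3)) (hy : y ∈ stdSimplex ℝ (Fin 3)) :
    routeLength i j x y ≤ 1 := by
  have := hx.1 j
  have := hy.1 i
  exact (min_le_left _ _).trans (by linarith)

theorem codeMetric_mem_Icc (a b : ℕ → Fin 3) : codeMetric a b ∈ Set.Icc (0 : ℝ) 1 := by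
  by_cases hab : a = b
  · rw [hab, codeMetric_self]
    simp
  rw [codeMetric, if_neg hab, codeDist_succ _ _ _ (PiNat.apply_firstDiff_ne hab)]
  refine ⟨mul_nonneg (by positivity)
      (routeLength_nonneg (bary_mem_stdSimplex _) (bary_mem_stdSimplex _)),
    mul_le_one₀ (pow_le_one₀ (by norm_num) (by norm_num))
      (routeLength_nonneg (bary_mem_stdSimplex _) (bary_mem_stdSimplex _))
      (routeLength_le_one (bary_mem_stdSimplex _) (bary_mem_stdSimplex _))⟩

/-! ### The triangle inequality -/

theorem stdSimplex_three {x : Fin 3 → ℝ} (hx : x ∈ stdSimplex ℝ (Fin 3)) :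
    0 ≤ x 0 ∧ 0 ≤ x 1 ∧ 0 ≤ x 2 ∧ x 0 + x 1 + x 2 = 1 :=
  ⟨hx.1 0, hx.1 1, hx.1 2, by rw [← Fin.sum_univ_three]; exact hx.2⟩

theorem sub_le_routeLength {i j : Fin 3} (hij : i ≠ j) (m : Fin 3) {x y : Fin 3 → ℝ}
    (hx : x ∈ stdSimplex ℝ (Fin 3)) (hy : y ∈ stdSimplex ℝ (Fin 3)) :
    ((if i = m then 1 else 0) + x m) / 2 - ((if j = m then 1 else 0) + y m) / 2
      ≤ routeLength i j x y := by
  obtain ⟨x0, x1, x2, xs⟩ := stdSimplex_three hx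
  obtain ⟨y0, y1, y2, ys⟩ := stdSimplex_three hy
  refine le_min ?_ ?_ <;> fin_cases i <;> fin_cases j <;> fin_cases m <;>
    first | exact absurd rfl hij | (simp; linarith)

/-- A route between two cells is not longer than the detour through the corner `m` of the whole
gasket. -/
theorem routeLength_le_corner {i j : Fin 3} (hij : i ≠ j) (m : Fin 3) {x y : Fin 3 → ℝ}
    (hx : x ∈ stdSimplex ℝ (Fin 3)) (hy : y ∈ stdSimplex ℝ (Fin 3)) :
    routeLength i j x y ≤
      2 - ((if i = m then 1 else 0) + x m) / 2 - ((if j = m then 1 else 0) + y m) / 2 := by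
  obtain ⟨x0, x1, x2, xs⟩ := stdSimplex_three hx
  obtain ⟨y0, y1, y2, ys⟩ := stdSimplex_three hy
  unfold routeLength
  rw [min_le_iff]
  fin_cases i <;> fin_cases j <;> fin_cases m <;>
    first | exact absurd rfl hij | (simp; left; linarith)

theorem add_add_eq_of_ne {i j k : Fin 3} (hij : i ≠ j) (hjk : j ≠ k) (hik : i ≠ k)
    (w : Fin 3 → ℝ) : w i + w j + w k = w 0 + w 1 + w 2 := by
  fin_cases i <;> fin_cases j <;> fin_cases k <;>
    first
      | exact absurd rfl hij
      | exact absurd rfl hjk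
      | exact absurd rfl hik
      | (simp; done)
      | (simp; ring)

/-- The sum of two barycentric coordinates is `1` minus the third one. -/
theorem exists_bary_add_bary_eq {i j : Fin 3} (hij : i ≠ j) :
    ∃ l, l ≠ i ∧ l ≠ j ∧ ∀ w : ℕ → Fin 3, bary w i + bary w j = 1 - bary w l := by
  obtain ⟨l, hi, hj⟩ : ∃ l : Fin 3, l ≠ i ∧ l ≠ j := by
    revert i j
    decide
  refine ⟨l, hi, hj, fun w => ?_⟩
  have h1 := add_add_eq_of_ne hij hj.symm hi.symm (bary w)
  have h2 := bary_sum w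
  linarith

theorem routeLength_triangle {i j k : Fin 3} (hij : i ≠ j) (hjk : j ≠ k) (hik : i ≠ k)
    {x y z : Fin 3 → ℝ} (hx : x ∈ stdSimplex ℝ (Fin 3)) (hy : y ∈ stdSimplex ℝ (Fin 3))
    (hz : z ∈ stdSimplex ℝ (Fin 3)) :
    routeLength i k x z ≤ routeLength i j x y + routeLength j k y z := by
  have key : ∀ {x0 x1 x2 y0 y1 y2 z0 z1 z2 : ℝ}, 0 ≤ x0 → 0 ≤ x1 → 0 ≤ x2 → x0 + x1 + x2 = 1 →
      0 ≤ y0 → 0 ≤ y1 → 0 ≤ y2 → y0 + y1 + y2 = 1 →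
      0 ≤ z0 → 0 ≤ z1 → 0 ≤ z2 → z0 + z1 + z2 = 1 →
      min ((2 - x2 - z0) / 2) ((1 + (x0 + x2) + (z0 + z2)) / 2) ≤
        min ((2 - x1 - y0) / 2) ((1 + (x0 + x1) + (y0 + y1)) / 2) +
        min ((2 - y2 - z1) / 2) ((1 + (y1 + y2) + (z1 + z2)) / 2) := by
    intros
    rw [min_add, add_min, add_min, le_min_iff, le_min_iff, le_min_iff, min_le_iff, min_le_iff,
      min_le_iff, min_le_iff]
    refine ⟨⟨Or.inr ?_, Or.inl ?_⟩, Or.inl ?_, Or.inl ?_⟩ <;> linarith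
  have hsum : ∀ {w : Fin 3 → ℝ}, w ∈ stdSimplex ℝ (Fin 3) → w i + w j + w k = 1 := fun hw =>
    (add_add_eq_of_ne hij hjk hik _).trans (stdSimplex_three hw).2.2.2
  exact key (hx.1 i) (hx.1 j) (hx.1 k) (hsum hx) (hy.1 i) (hy.1 j) (hy.1 k)
    (hsum hy) (hz.1 i) (hz.1 j) (hz.1 k) (hsum hz)

/-- The barycentric coordinates are `1`-Lipschitz for the distance of codes. -/
theorem bary_sub_le_codeMetric (a b : ℕ → Fin 3) (m : Fin 3) :
    bary a m - bary b m ≤ codeMetric a b := by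
  refine le_of_forall_le_add_half_pow fun n => ?_
  induction n generalizing a b with
  | zero =>
    linarith [bary_le_one a m, bary_nonneg b m, (codeMetric_mem_Icc a b).1]
  | succ n ih =>
    rw [bary_eq_half a, bary_eq_half b]
    by_cases h : a 0 = b 0
    · rw [codeMetric_of_eq h, h, pow_succ]
      linarith [ih (dropDigits 1 a) (dropDigits 1 b)]
    · rw [codeMetric_of_ne h]
      have := sub_le_routeLength h m (bary_mem_stdSimplex (dropDigits 1 a))
        (bary_mem_stdSimplex (dropDigits 1 b))
      have : (0 : ℝ) ≤ (1 / 2) ^ (n + 1) := by positivity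
      linarith

/-- The distance of two codes is at most the length of the route through a corner of the gasket:
the distance to the corner `m` is `1 - bary a m`. -/
theorem codeMetric_le_corner (a b : ℕ → Fin 3) (m : Fin 3) :
    codeMetric a b ≤ 2 - bary a m - bary b m := by
  refine le_of_forall_le_add_half_pow fun n => ?_
  induction n generalizing a b with
  | zero =>
    linarith [bary_le_one a m, bary_le_one b m, (codeMetric_mem_Icc a b).2]
  | succ n ih =>
    rw [bary_eq_half a, bary_eq_half b]
    by_cases h : a 0 = b 0
    · rw [codeMetric_of_eq h, h, pow_succ]
      have := ih (dropDigits 1 a) (dropDigits 1 b)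
      split_ifs <;> linarith
    · rw [codeMetric_of_ne h]
      have := routeLength_le_corner h m (bary_mem_stdSimplex (dropDigits 1 a))
        (bary_mem_stdSimplex (dropDigits 1 b))
      have : (0 : ℝ) ≤ (1 / 2) ^ (n + 1) := by positivity
      linarith

/-- Moving one end of a route inside its cell changes the length of the route by at most the
distance moved, because the coordinates are `1`-Lipschitz. -/
theorem codeMetric_triangle_of_eq_left {a b c : ℕ → Fin 3} (hab : a 0 = b 0) (hac : a 0 ≠ c 0) :
    codeMetric a c ≤ codeMetric a b + codeMetric b c := by
  rw [codeMetric_of_eq hab, codeMetric_of_ne hac,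
    codeMetric_of_ne (a := b) (b := c) (hab ▸ hac), ← hab]
  set x := dropDigits 1 a
  set y := dropDigits 1 b
  set z := dropDigits 1 c
  have h1 := bary_sub_le_codeMetric y x (c 0)
  rw [codeMetric_comm] at h1
  have h2 : bary x (a 0) + bary x (c 0) - (bary y (a 0) + bary y (c 0)) ≤ codeMetric x y := by
    obtain ⟨l, -, -, hl⟩ := exists_bary_add_bary_eq hac
    rw [hl, hl]
    have := bary_sub_le_codeMetric y x l
    rw [codeMetric_comm] at this
    linarith
  unfold routeLength
  rw [add_min, le_min_iff]
  refine ⟨(min_le_left _ _).trans ?_, (min_le_right _ _).trans ?_⟩ <;> linarith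

/-- A detour through another cell is not shorter than staying in the cell. -/
theorem codeMetric_triangle_of_eq_ends {a b c : ℕ → Fin 3} (hac : a 0 = c 0) (hab : a 0 ≠ b 0) :
    codeMetric a c ≤ codeMetric a b + codeMetric b c := by
  rw [codeMetric_comm b c, codeMetric_of_eq hac, codeMetric_of_ne hab,
    codeMetric_of_ne (a := c) (b := b) (hac ▸ hab), ← hac]
  set x := dropDigits 1 a
  set y := dropDigits 1 b
  set z := dropDigits 1 c
  obtain ⟨l, -, -, hl⟩ := exists_bary_add_bary_eq hab
  have h1 := codeMetric_le_corner x z (b 0)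
  have h2 := codeMetric_le_corner x z l
  have h3 := (codeMetric_mem_Icc x z).2
  have hx := bary_le_one x (b 0)
  have hx' := bary_le_one x l
  have hz := bary_le_one z (b 0)
  have hz' := bary_le_one z l
  have hy := hl y
  have hy0 := bary_nonneg y (b 0)
  have hy1 := bary_nonneg y (a 0)
  have hy2 := bary_nonneg y l
  unfold routeLength
  rw [hl, hl, hl, min_add, add_min, add_min, le_min_iff, le_min_iff, le_min_iff]
  refine ⟨⟨?_, ?_⟩, ?_, ?_⟩ <;> linarith

theorem codeMetric_triangle (a b c : ℕ → Fin 3) :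
    codeMetric a c ≤ codeMetric a b + codeMetric b c := by
  refine le_of_forall_le_add_half_pow fun n => ?_
  induction n generalizing a b c with
  | zero =>
    linarith [(codeMetric_mem_Icc a c).2, (codeMetric_mem_Icc a b).1, (codeMetric_mem_Icc b c).1]
  | succ n ih =>
    have hn : (0 : ℝ) ≤ (1 / 2) ^ (n + 1) := by positivity
    by_cases hab : a 0 = b 0
    · by_cases hac : a 0 = c 0
      · rw [codeMetric_of_eq hab, codeMetric_of_eq hac,
          codeMetric_of_eq (a := b) (b := c) (hab ▸ hac), pow_succ]
        linarith [ih (dropDigits 1 a) (dropDigits 1 b) (dropDigits 1 c)]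
      · linarith [codeMetric_triangle_of_eq_left hab hac]
    · by_cases hac : a 0 = c 0
      · linarith [codeMetric_triangle_of_eq_ends hac hab]
      · by_cases hbc : b 0 = c 0
        · have := codeMetric_triangle_of_eq_left (a := c) (b := b) (c := a) hbc.symm
            (Ne.symm hac)
          rw [codeMetric_comm c a, codeMetric_comm c b, codeMetric_comm b a] at this
          linarith
        · rw [codeMetric_of_ne hab, codeMetric_of_ne hac, codeMetric_of_ne hbc]
          have := routeLength_triangle hab hbc hac (bary_mem_stdSimplex (dropDigits 1 a))
            (bary_mem_stdSimplex (dropDigits 1 b)) (bary_mem_stdSimplex (dropDigits 1 c))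
          linarith

/-! ### The points of the gasket and their codes -/

/-- The code `a` with the digit `i` prepended. -/
def consDigit (i : Fin 3) (a : ℕ → Fin 3) : ℕ → Fin 3
  | 0 => i
  | n + 1 => a n

@[simp]
theorem consDigit_zero (i : Fin 3) (a : ℕ → Fin 3) : consDigit i a 0 = i := rfl

@[simp]
theorem dropDigits_consDigit (i : Fin 3) (a : ℕ → Fin 3) : dropDigits 1 (consDigit i a) = a := by
  ext n
  rw [dropDigits, add_comm]
  rfl

theorem consDigit_dropDigits (a : ℕ → Fin 3) : consDigit (a 0) (dropDigits 1 a) = a := by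
  ext n
  cases n with
  | zero => rfl
  | succ n => rw [consDigit, dropDigits, add_comm]

theorem dropDigits_dropDigits (m n : ℕ) (a : ℕ → Fin 3) :
    dropDigits m (dropDigits n a) = dropDigits (n + m) a :=
  funext fun i => by simp only [dropDigits, add_assoc]

theorem dropDigits_zero (a : ℕ → Fin 3) : dropDigits 0 a = a :=
  funext fun i => by rw [dropDigits, zero_add]

theorem agree_dropDigits {a b : ℕ → Fin 3} {n : ℕ} (h : ∀ i < n + 1, a i = b i) :
    ∀ i < n, dropDigits 1 a i = dropDigits 1 b i := fun i hi => h (1 + i) (by omega)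

theorem bary_consDigit (i : Fin 3) (a : ℕ → Fin 3) (m : Fin 3) :
    bary (consDigit i a) m = ((if i = m then 1 else 0) + bary a m) / 2 := by
  rw [bary_eq_half, dropDigits_consDigit, consDigit_zero]

theorem continuous_bary (m : Fin 3) : Continuous fun a : ℕ → Fin 3 => bary a m := by
  refine continuous_tsum (fun i => ?_) summable_half_pow_succ (fun i a => ?_)
  · exact (continuous_of_discreteTopology
      (f := fun d : Fin 3 => if d = m then (1 / 2 : ℝ) ^ (i + 1) else 0)).comp (continuous_apply i)
  · rw [Real.norm_eq_abs]
    split_ifs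
    · rw [abs_of_nonneg (by positivity)]
    · rw [abs_zero]
      positivity

/-- The point of the plane with code `a`. -/
noncomputable def codePoint (a : ℕ → Fin 3) : EuclideanSpace ℝ (Fin 2) :=
  !₂[bary a 1 + bary a 2 / 2, √3 / 2 * bary a 2]

theorem codePoint_eq_iff {a b : ℕ → Fin 3} :
    codePoint a = codePoint b ↔ ∀ m, bary a m = bary b m := by
  constructor
  · intro h
    have h0 : codePoint a 0 = codePoint b 0 := by rw [h]
    have h1 : codePoint a 1 = codePoint b 1 := by rw [h]
    simp only [codePoint, PiLp.toLp_apply, Matrix.cons_val_zero, Matrix.cons_val_one] at h0 h1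
    have h2 : bary a 2 = bary b 2 := mul_left_cancel₀ (by positivity) h1
    have ha := bary_sum a
    have hb := bary_sum b
    intro m
    fin_cases m <;> simp <;> linarith
  · intro h
    rw [codePoint, codePoint, h, h]

theorem codePoint_consDigit (i : Fin 3) (a : ℕ → Fin 3) :
    codePoint (consDigit i a) = gasketMap i (codePoint a) := by
  ext j
  fin_cases i <;> fin_cases j <;>
    simp [codePoint, gasketMap, bary_consDigit] <;> ring

theorem gasketMap_codePoint (a : ℕ → Fin 3) :
    gasketMap (a 0) (codePoint (dropDigits 1 a)) = codePoint a := by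
  rw [← codePoint_consDigit, consDigit_dropDigits]

theorem continuous_codePoint : Continuous codePoint := by
  refine (PiLp.continuous_toLp 2 _).comp (continuous_pi fun j => ?_)
  fin_cases j
  · exact (continuous_bary 1).add ((continuous_bary 2).div_const 2)
  · exact continuous_const.mul (continuous_bary 2)

theorem range_codePoint : Set.range codePoint = gasket := by
  rw [← isAttractor_iff_eq_gasket]
  refine ⟨isCompact_range continuous_codePoint, Set.range_nonempty _, ?_⟩
  ext p
  simp only [Set.mem_iUnion, Set.mem_image, Set.mem_range, exists_exists_eq_and]
  constructor
  · rintro ⟨a, rfl⟩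
    exact ⟨a 0, dropDigits 1 a, gasketMap_codePoint a⟩
  · rintro ⟨i, a, rfl⟩
    exact ⟨consDigit i a, codePoint_consDigit i a⟩

theorem mem_subTriangle_iff (k : ℕ) (a : ℕ → Fin 3) (p : EuclideanSpace ℝ (Fin 2)) :
    p ∈ subTriangle (List.ofFn fun j : Fin k => a j) ↔
      ∃ b, (∀ i < k, b i = a i) ∧ codePoint b = p := by
  induction k generalizing a p with
  | zero => simp [subTriangle, ← range_codePoint]
  | succ k ih =>
    have h := ih (dropDigits 1 a)
    have hl : (List.ofFn fun j : Fin (k + 1) => a j) =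
        a 0 :: List.ofFn fun j : Fin k => dropDigits 1 a j := by
      rw [List.ofFn_succ]
      simp [dropDigits, add_comm]
    rw [hl, subTriangle]
    constructor
    · rintro ⟨q, hq, rfl⟩
      obtain ⟨b, hb, rfl⟩ := (h q).1 hq
      refine ⟨consDigit (a 0) b, fun i hi => ?_, codePoint_consDigit _ _⟩
      cases i with
      | zero => rfl
      | succ i => exact (hb i (by omega)).trans (by rw [dropDigits, add_comm])
    · rintro ⟨b, hb, rfl⟩
      refine ⟨codePoint (dropDigits 1 b), (h _).2 ⟨_, agree_dropDigits hb, rfl⟩, ?_⟩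
      rw [← hb 0 (by omega), gasketMap_codePoint]

/-! ### Comparison with the Euclidean distance -/

theorem dist_codePoint (a b : ℕ → Fin 3) : dist (codePoint a) (codePoint b) =
    √((bary a 1 - bary b 1) ^ 2 + (bary a 1 - bary b 1) * (bary a 2 - bary b 2) +
      (bary a 2 - bary b 2) ^ 2) := by
  rw [EuclideanSpace.dist_eq]
  congr 1
  rw [Fin.sum_univ_two, Real.dist_eq, Real.dist_eq, sq_abs, sq_abs]
  simp only [codePoint, PiLp.toLp_apply, Matrix.cons_val_zero, Matrix.cons_val_one]
  have h3 : √3 ^ 2 = 3 := Real.sq_sqrt (by norm_num)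
  linear_combination (bary a 2 - bary b 2) ^ 2 / 4 * h3

theorem dist_codePoint_of_eq {a b : ℕ → Fin 3} (h : a 0 = b 0) :
    dist (codePoint a) (codePoint b) =
      dist (codePoint (dropDigits 1 a)) (codePoint (dropDigits 1 b)) / 2 := by
  rw [← gasketMap_codePoint a, ← gasketMap_codePoint b, h, gasketMap_dist]
  ring

theorem dist_codePoint_of_agree {n : ℕ} {a b : ℕ → Fin 3} (h : ∀ i < n, a i = b i) :
    dist (codePoint a) (codePoint b) =
      (1 / 2) ^ n * dist (codePoint (dropDigits n a)) (codePoint (dropDigits n b)) := by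
  induction n generalizing a b with
  | zero => rw [dropDigits_zero, dropDigits_zero, pow_zero, one_mul]
  | succ n ih =>
    rw [dist_codePoint_of_eq (h 0 (by omega)), ih (agree_dropDigits h), dropDigits_dropDigits,
      dropDigits_dropDigits, add_comm 1 n, pow_succ]
    ring

theorem codeMetric_of_agree {n : ℕ} {a b : ℕ → Fin 3} (h : ∀ i < n, a i = b i) :
    codeMetric a b = (1 / 2) ^ n * codeMetric (dropDigits n a) (dropDigits n b) := by
  induction n generalizing a b with
  | zero => rw [dropDigits_zero, dropDigits_zero, pow_zero, one_mul]
  | succ n ih =>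
    rw [codeMetric_of_eq (h 0 (by omega)), ih (agree_dropDigits h), dropDigits_dropDigits,
      dropDigits_dropDigits, add_comm 1 n, pow_succ]
    ring

theorem codeMetric_le_of_agree {n : ℕ} {a b : ℕ → Fin 3} (h : ∀ i < n, a i = b i) :
    codeMetric a b ≤ (1 / 2) ^ n := by
  rw [codeMetric_of_agree h]
  exact mul_le_of_le_one_right (by positivity) (codeMetric_mem_Icc _ _).2

theorem dist_corner_corner {i j : Fin 3} (hij : i ≠ j) :
    dist (codePoint fun _ => i) (codePoint fun _ => j) = 1 := by
  rw [dist_codePoint, Real.sqrt_eq_one]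
  simp only [bary_const]
  fin_cases i <;> fin_cases j <;> first | exact absurd rfl hij | simp

theorem dist_corner_le (a : ℕ → Fin 3) (j : Fin 3) :
    dist (codePoint a) (codePoint fun _ => j) ≤ 1 - bary a j := by
  rw [dist_codePoint]
  simp only [bary_const]
  have h0 := bary_nonneg a 0
  have h1 := bary_nonneg a 1
  have h2 := bary_nonneg a 2
  have hs := bary_sum a
  refine Real.sqrt_le_iff.2 ⟨by linarith [bary_le_one a j], ?_⟩
  have h01 := mul_nonneg h0 h1
  have h02 := mul_nonneg h0 h2
  have h12 := mul_nonneg h1 h2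
  have e0 : bary a 0 = 1 - bary a 1 - bary a 2 := by linarith
  rw [e0] at h01 h02
  fin_cases j
  · simp only [Fin.zero_eta, zero_ne_one, if_false, (by decide : (0 : Fin 3) ≠ 2), e0]
    nlinarith
  · simp only [Fin.mk_one, if_true, (by decide : (1 : Fin 3) ≠ 2), if_false]
    nlinarith
  · simp only [Fin.reduceFinMk, if_true, (by decide : (2 : Fin 3) ≠ 1), if_false]
    nlinarith

/-- The cells `i` and `j` have a common corner, with one code in each of them. -/
theorem codePoint_consDigit_const (i j : Fin 3) :
    codePoint (consDigit i fun _ => j) = codePoint (consDigit j fun _ => i) :=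
  codePoint_eq_iff.2 fun m => by rw [bary_consDigit, bary_consDigit, bary_const, bary_const,
    add_comm]

theorem dist_le_routeLength {a b : ℕ → Fin 3} (h : a 0 ≠ b 0) :
    dist (codePoint a) (codePoint b) ≤
      routeLength (a 0) (b 0) (bary (dropDigits 1 a)) (bary (dropDigits 1 b)) := by
  have hc : ∀ (c : ℕ → Fin 3) (m : Fin 3),
      dist (codePoint c) (codePoint (consDigit (c 0) fun _ => m)) ≤
        (1 - bary (dropDigits 1 c) m) / 2 := by
    intro c m
    rw [dist_codePoint_of_eq (consDigit_zero _ _).symm, dropDigits_consDigit]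
    linarith [dist_corner_le (dropDigits 1 c) m]
  refine le_min ?_ ?_
  · have h1 := dist_triangle_right (codePoint a) (codePoint b)
      (codePoint (consDigit (a 0) fun _ => b 0))
    have h2 := hc a (b 0)
    have h3 := hc b (a 0)
    rw [codePoint_consDigit_const] at h3
    linarith
  · obtain ⟨l, -, -, hl⟩ := exists_bary_add_bary_eq h
    have h1 := dist_triangle4_right (codePoint a) (codePoint b)
      (codePoint (consDigit (a 0) fun _ => l)) (codePoint (consDigit (b 0) fun _ => l))
    have h2 := hc a l
    have h3 := hc b l
    have h4 : dist (codePoint (consDigit (a 0) fun _ => l))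
        (codePoint (consDigit (b 0) fun _ => l)) = 1 / 2 := by
      rw [codePoint_consDigit_const, codePoint_consDigit_const (b 0), codePoint_consDigit,
        codePoint_consDigit, gasketMap_dist, dist_corner_corner h, mul_one]
    rw [hl, hl]
    linarith

theorem dist_le_codeMetric (a b : ℕ → Fin 3) :
    dist (codePoint a) (codePoint b) ≤ codeMetric a b := by
  by_cases hab : a = b
  · rw [hab, dist_self, codeMetric_self]
  have hn : ∀ i < PiNat.firstDiff a b, a i = b i := fun i hi => PiNat.apply_eq_of_lt_firstDiff hi
  have hne : dropDigits (PiNat.firstDiff a b) a 0 ≠ dropDigits (PiNat.firstDiff a b) b 0 :=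
    PiNat.apply_firstDiff_ne hab
  rw [dist_codePoint_of_agree hn, codeMetric_of_agree hn, codeMetric_of_ne hne]
  exact mul_le_mul_of_nonneg_left (dist_le_routeLength hne) (by positivity)

/-- A point that has codes in two different cells of the same level is their common corner. -/
theorem dropDigits_eq_const_of_codePoint_eq {n : ℕ} {a b : ℕ → Fin 3}
    (h : codePoint a = codePoint b) (hn : ∀ i < n, a i = b i) (hne : a n ≠ b n) :
    dropDigits (n + 1) a = (fun _ => b n) ∧ dropDigits (n + 1) b = fun _ => a n := by
  have hd : codePoint (dropDigits n a) = codePoint (dropDigits n b) := by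
    have h1 := dist_codePoint_of_agree hn
    rw [h, dist_self] at h1
    exact dist_eq_zero.1 ((mul_eq_zero.1 h1.symm).resolve_left (by positivity))
  rw [codePoint_eq_iff] at hd
  have key := fun m => (bary_eq_half (dropDigits n a) m).symm.trans
    ((hd m).trans (bary_eq_half (dropDigits n b) m))
  simp only [dropDigits_dropDigits, dropDigits, add_zero] at key
  refine ⟨eq_const_of_bary_eq_one (le_antisymm (bary_le_one _ _) ?_),
    eq_const_of_bary_eq_one (le_antisymm (bary_le_one _ _) ?_)⟩
  · have h1 := key (b n)
    rw [if_neg hne, if_pos rfl] at h1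
    have := bary_nonneg (dropDigits (n + 1) b) (b n)
    linarith
  · have h1 := key (a n)
    rw [if_neg hne.symm, if_pos rfl] at h1
    have := bary_nonneg (dropDigits (n + 1) a) (a n)
    linarith

theorem codeMetric_eq_zero_iff {a b : ℕ → Fin 3} :
    codeMetric a b = 0 ↔ codePoint a = codePoint b := by
  refine ⟨fun h => dist_le_zero.1 (h ▸ dist_le_codeMetric a b), fun h => ?_⟩
  by_cases hab : a = b
  · rw [hab, codeMetric_self]
  have hne := PiNat.apply_firstDiff_ne hab
  have hn : ∀ i < PiNat.firstDiff a b, a i = b i := fun i hi => PiNat.apply_eq_of_lt_firstDiff hi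
  obtain ⟨h1, h2⟩ := dropDigits_eq_const_of_codePoint_eq h hn hne
  rw [codeMetric, if_neg hab, codeDist_succ _ _ _ hne, h1, h2, routeLength]
  norm_num [bary_const, hne, hne.symm]

/-! ### The metric on the gasket -/

/-- The point of the gasket with code `a`. -/
noncomputable def gasketPoint (a : ℕ → Fin 3) : gasket :=
  ⟨codePoint a, range_codePoint ▸ Set.mem_range_self a⟩

theorem gasketPoint_surjective : Function.Surjective gasketPoint := by
  rintro ⟨p, hp⟩
  rw [← range_codePoint] at hp
  obtain ⟨a, ha⟩ := hp
  exact ⟨a, Subtype.ext ha⟩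

theorem isCode_iff (a : ℕ → Fin 3) (x : gasket) : IsCode a x ↔ gasketPoint a = x := by
  constructor
  · intro h
    refine Subtype.ext (dist_le_zero.1 (le_of_forall_le_add_half_pow fun n => ?_))
    obtain ⟨b, hb, hbx⟩ := (mem_subTriangle_iff n a x).1 (h n)
    rw [← hbx, zero_add]
    exact (dist_le_codeMetric a b).trans (codeMetric_le_of_agree fun i hi => (hb i hi).symm)
  · rintro rfl k
    exact (mem_subTriangle_iff k a _).2 ⟨a, fun _ _ => rfl, rfl⟩

/-- The distance on the gasket, computed with an arbitrary choice of codes. -/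
noncomputable def gasketDist (x y : gasket) : ℝ :=
  codeMetric (Function.surjInv gasketPoint_surjective x) (Function.surjInv gasketPoint_surjective y)

/-- The distance does not depend on the choice of codes. -/
theorem gasketDist_gasketPoint (a b : ℕ → Fin 3) :
    gasketDist (gasketPoint a) (gasketPoint b) = codeMetric a b := by
  have key : ∀ c, codeMetric c (Function.surjInv gasketPoint_surjective (gasketPoint c)) = 0 :=
    fun c => codeMetric_eq_zero_iff.2
      (congrArg Subtype.val (Function.surjInv_eq gasketPoint_surjective (gasketPoint c))).symm
  have ha := key a
  have hb := key b
  unfold gasketDist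
  set a' := Function.surjInv gasketPoint_surjective (gasketPoint a)
  set b' := Function.surjInv gasketPoint_surjective (gasketPoint b)
  have h1 := codeMetric_triangle a' a b'
  have h2 := codeMetric_triangle a b b'
  have h3 := codeMetric_triangle a a' b
  have h4 := codeMetric_triangle a' b' b
  rw [codeMetric_comm a' a] at h1
  rw [codeMetric_comm b' b] at h4
  linarith

theorem dist_le_gasketDist (x y : gasket) : dist x y ≤ gasketDist x y := by
  obtain ⟨a, rfl⟩ := gasketPoint_surjective x
  obtain ⟨b, rfl⟩ := gasketPoint_surjective y
  rw [gasketDist_gasketPoint]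
  exact dist_le_codeMetric a b

theorem gasketDist_self (x : gasket) : gasketDist x x = 0 := codeMetric_self _

theorem gasketDist_comm (x y : gasket) : gasketDist x y = gasketDist y x := codeMetric_comm _ _

theorem gasketDist_triangle (x y z : gasket) :
    gasketDist x z ≤ gasketDist x y + gasketDist y z := codeMetric_triangle _ _ _

theorem gasketDist_nonneg (x y : gasket) : 0 ≤ gasketDist x y := (codeMetric_mem_Icc _ _).1

/-- The gasket with the distance given by codes. -/
noncomputable abbrev gasketMetric : MetricSpace gasket where
  dist := gasketDist
  dist_self := gasketDist_self
  dist_comm := gasketDist_comm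
  dist_triangle := gasketDist_triangle
  eq_of_dist_eq_zero {x y} h := dist_le_zero.1 (h ▸ dist_le_gasketDist x y)

theorem isCodeDistance_gasketDist : IsCodeDistance gasketDist := by
  refine ⟨gasketDist_self, fun x y a b k ha hb hk => ?_⟩
  rw [isCode_iff] at ha hb
  rw [← ha, ← hb, gasketDist_gasketPoint, codeMetric_eq_codeDist hk]

/-! ### Shortest curves to a corner -/

/-- The digits of the point at coordinate `t` on a shortest curve from the point with code `a` to
the corner `j`, the curve being parametrized by the barycentric coordinate with index `j`. In the
cell `j` it follows a shortest curve of that cell; from another cell `i` it goes to the common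
corner of the cells `i` and `j` at coordinate `1 / 2`, and from there along the edge of the
cell `j`. -/
noncomputable def digitTowardsCorner (j : Fin 3) : ℕ → (ℕ → Fin 3) → ℝ → Fin 3
  | 0, a, t => if t < 1 / 2 then a 0 else j
  | n + 1, a, t =>
    if a 0 = j then digitTowardsCorner j n (dropDigits 1 a) (2 * t - 1)
    else if t < 1 / 2 then digitTowardsCorner j n (dropDigits 1 a) (2 * t)
    else digitTowardsCorner j n (fun _ => a 0) (2 * t - 1)

/-- The code of the point at coordinate `t` on a shortest curve from the point with code `a` to the
corner `j`. It is meaningful for `bary a j ≤ t ≤ 1`. -/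
noncomputable def codeTowardsCorner (j : Fin 3) (a : ℕ → Fin 3) (t : ℝ) : ℕ → Fin 3 :=
  fun n => digitTowardsCorner j n a t

section CodeTowardsCorner

variable {j : Fin 3} {a : ℕ → Fin 3} {s t : ℝ}

theorem codeTowardsCorner_of_eq (h : a 0 = j) : codeTowardsCorner j a t =
    consDigit j (codeTowardsCorner j (dropDigits 1 a) (2 * t - 1)) := by
  ext n
  cases n <;> simp [codeTowardsCorner, digitTowardsCorner, consDigit, h]

theorem codeTowardsCorner_of_lt (h : a 0 ≠ j) (ht : t < 1 / 2) : codeTowardsCorner j a t =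
    consDigit (a 0) (codeTowardsCorner j (dropDigits 1 a) (2 * t)) := by
  ext n
  cases n <;> simp only [codeTowardsCorner, digitTowardsCorner, consDigit, h, ht, if_true, if_false]

theorem codeTowardsCorner_of_le (h : a 0 ≠ j) (ht : 1 / 2 ≤ t) : codeTowardsCorner j a t =
    consDigit j (codeTowardsCorner j (fun _ => a 0) (2 * t - 1)) := by
  ext n
  cases n <;> simp only [codeTowardsCorner, digitTowardsCorner, consDigit, h, ht.not_gt, if_false]

theorem bary_codeTowardsCorner (h0 : bary a j ≤ t) (h1 : t ≤ 1) :
    bary (codeTowardsCorner j a t) j = t := by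
  refine sub_eq_zero.1 (abs_nonpos_iff.1 (le_of_forall_le_add_half_pow fun n => ?_))
  rw [zero_add]
  induction n generalizing a t with
  | zero =>
    rw [pow_zero, abs_le]
    have := bary_nonneg a j
    have := bary_nonneg (codeTowardsCorner j a t) j
    have := bary_le_one (codeTowardsCorner j a t) j
    constructor <;> linarith
  | succ n ih =>
    rw [bary_eq_half] at h0
    rw [pow_succ]
    by_cases h : a 0 = j
    · rw [if_pos h] at h0
      have := abs_le.1 (ih (a := dropDigits 1 a) (t := 2 * t - 1) (by linarith) (by linarith))
      rw [codeTowardsCorner_of_eq h, bary_consDigit, if_pos rfl, abs_le]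
      constructor <;> linarith
    rw [if_neg h] at h0
    rcases lt_or_ge t (1 / 2) with ht | ht
    · have := abs_le.1 (ih (a := dropDigits 1 a) (t := 2 * t) (by linarith) (by linarith))
      rw [codeTowardsCorner_of_lt h ht, bary_consDigit, if_neg h, abs_le]
      constructor <;> linarith
    · have := abs_le.1 (ih (a := fun _ => a 0) (t := 2 * t - 1)
        (by rw [bary_const, if_neg h]; linarith) (by linarith))
      rw [codeTowardsCorner_of_le h ht, bary_consDigit, if_pos rfl, abs_le]
      constructor <;> linarith

/-- The curve from the corner `i` to the corner `j` runs along the edge between them. -/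
theorem bary_codeTowardsCorner_const {i : Fin 3} (hij : i ≠ j) (h0 : 0 ≤ t) (h1 : t ≤ 1) :
    bary (codeTowardsCorner j (fun _ => i) t) i = 1 - t := by
  refine sub_eq_zero.1 (abs_nonpos_iff.1 (le_of_forall_le_add_half_pow fun n => ?_))
  rw [zero_add]
  induction n generalizing t with
  | zero =>
    rw [pow_zero, abs_le]
    have := bary_nonneg (codeTowardsCorner j (fun _ => i) t) i
    have := bary_le_one (codeTowardsCorner j (fun _ => i) t) i
    constructor <;> linarith
  | succ n ih =>
    rw [pow_succ]
    rcases lt_or_ge t (1 / 2) with ht | ht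
    · have := abs_le.1 (ih (t := 2 * t) (by linarith) (by linarith))
      rw [codeTowardsCorner_of_lt hij ht, 
        show dropDigits 1 (fun _ => i) = fun _ => i from rfl,
        bary_consDigit, if_pos rfl, abs_le]
      constructor <;> linarith
    · have := abs_le.1 (ih (t := 2 * t - 1) (by linarith) (by linarith))
      rw [codeTowardsCorner_of_le hij ht, bary_consDigit, if_neg hij.symm, abs_le]
      constructor <;> linarith

theorem codeMetric_consDigit (i : Fin 3) (a b : ℕ → Fin 3) :
    codeMetric (consDigit i a) (consDigit i b) = codeMetric a b / 2 := by
  rw [codeMetric_of_eq (a := consDigit i a) (b := consDigit i b) rfl,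
    dropDigits_consDigit, dropDigits_consDigit]

theorem codeMetric_consDigit_le {i j : Fin 3} (hij : i ≠ j) (a b : ℕ → Fin 3) :
    codeMetric (consDigit i a) (consDigit j b) ≤ (2 - bary a j - bary b i) / 2 := by
  rw [codeMetric_of_ne hij, dropDigits_consDigit, dropDigits_consDigit]
  exact min_le_left _ _

theorem codeMetric_codeTowardsCorner_le (h0 : bary a j ≤ s) (hst : s ≤ t) (h1 : t ≤ 1) :
    codeMetric (codeTowardsCorner j a s) (codeTowardsCorner j a t) ≤ t - s := by
  refine le_of_forall_le_add_half_pow fun n => ?_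
  induction n generalizing a s t with
  | zero =>
    have := (codeMetric_mem_Icc (codeTowardsCorner j a s) (codeTowardsCorner j a t)).2
    linarith
  | succ n ih =>
    have hn : (0 : ℝ) ≤ (1 / 2) ^ n := by positivity
    have h0' := h0
    rw [bary_eq_half] at h0
    rw [pow_succ]
    by_cases h : a 0 = j
    · rw [if_pos h] at h0
      rw [codeTowardsCorner_of_eq h, codeTowardsCorner_of_eq h, codeMetric_consDigit]
      linarith [ih (a := dropDigits 1 a) (s := 2 * s - 1) (t := 2 * t - 1) (by linarith)
        (by linarith) (by linarith)]
    rw [if_neg h] at h0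
    rcases lt_or_ge t (1 / 2) with ht | ht
    · rw [codeTowardsCorner_of_lt h ht, codeTowardsCorner_of_lt h (hst.trans_lt ht),
        codeMetric_consDigit]
      linarith [ih (a := dropDigits 1 a) (s := 2 * s) (t := 2 * t) (by linarith)
        (by linarith) (by linarith)]
    rcases lt_or_ge s (1 / 2) with hs | hs
    · have h2 := codeMetric_consDigit_le h (codeTowardsCorner j (dropDigits 1 a) (2 * s))
        (codeTowardsCorner j (fun _ => a 0) (2 * t - 1))
      rw [bary_codeTowardsCorner (by linarith) (by linarith),
        bary_codeTowardsCorner_const h (by linarith) (by linarith)] at h2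
      rw [codeTowardsCorner_of_lt h hs, codeTowardsCorner_of_le h ht]
      linarith
    · rw [codeTowardsCorner_of_le h hs, codeTowardsCorner_of_le h ht, codeMetric_consDigit]
      linarith [ih (a := fun _ => a 0) (s := 2 * s - 1) (t := 2 * t - 1)
        (by rw [bary_const, if_neg h]; linarith) (by linarith) (by linarith)]

theorem codeMetric_codeTowardsCorner_start_le (h0 : bary a j ≤ t) (h1 : t ≤ 1) :
    codeMetric a (codeTowardsCorner j a t) ≤ t - bary a j := by
  refine le_of_forall_le_add_half_pow fun n => ?_
  induction n generalizing a t with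
  | zero =>
    have := (codeMetric_mem_Icc a (codeTowardsCorner j a t)).2
    linarith
  | succ n ih =>
    have hn : (0 : ℝ) ≤ (1 / 2) ^ n := by positivity
    rw [pow_succ]
    rw [bary_eq_half] at h0 ⊢
    nth_rewrite 1 [← consDigit_dropDigits a]
    by_cases h : a 0 = j
    · rw [if_pos h] at h0 ⊢
      rw [codeTowardsCorner_of_eq h, h, codeMetric_consDigit]
      linarith [ih (a := dropDigits 1 a) (t := 2 * t - 1) (by linarith) (by linarith)]
    rw [if_neg h] at h0 ⊢
    rcases lt_or_ge t (1 / 2) with ht | ht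
    · rw [codeTowardsCorner_of_lt h ht, codeMetric_consDigit]
      linarith [ih (a := dropDigits 1 a) (t := 2 * t) (by linarith) (by linarith)]
    · have h2 := codeMetric_consDigit_le h (dropDigits 1 a)
        (codeTowardsCorner j (fun _ => a 0) (2 * t - 1))
      rw [bary_codeTowardsCorner_const h (by linarith) (by linarith)] at h2
      rw [codeTowardsCorner_of_le h ht]
      linarith

end CodeTowardsCorner

/-! ### Geodesics of the gasket -/

/-- The points `x` and `y` are the values at `0` and `ℓ` of a curve in the gasket that is
`1`-Lipschitz for `gasketDist`. -/
def JoinedByLipschitz (x y : gasket) (ℓ : ℝ) : Prop :=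
  ∃ γ : ℝ → gasket, γ 0 = x ∧ γ ℓ = y ∧ ∀ s t, gasketDist (γ s) (γ t) ≤ |s - t|

theorem JoinedByLipschitz.symm {x y : gasket} {ℓ : ℝ} (h : JoinedByLipschitz x y ℓ) :
    JoinedByLipschitz y x ℓ := by
  obtain ⟨γ, h0, h1, h2⟩ := h
  refine ⟨fun t => γ (ℓ - t), by simpa using h1, by simpa using h0, fun s t => ?_⟩
  refine (h2 _ _).trans_eq ?_
  rw [sub_sub_sub_cancel_left, abs_sub_comm]

theorem JoinedByLipschitz.trans {x y z : gasket} {ℓ m : ℝ} (hℓ : 0 ≤ ℓ) (hm : 0 ≤ m)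
    (hxy : JoinedByLipschitz x y ℓ) (hyz : JoinedByLipschitz y z m) :
    JoinedByLipschitz x z (ℓ + m) := by
  obtain ⟨γ, h0, h1, h2⟩ := hxy
  obtain ⟨η, k0, k1, k2⟩ := hyz
  have key : ∀ s t, s ≤ ℓ → ℓ < t → gasketDist (γ s) (η (t - ℓ)) ≤ |s - t| := by
    intro s t hs ht
    have e1 := gasketDist_triangle (γ s) y (η (t - ℓ))
    have e2 := h2 s ℓ
    have e3 := k2 0 (t - ℓ)
    rw [h1, abs_of_nonpos (by linarith)] at e2
    rw [k0, abs_of_nonpos (by linarith)] at e3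
    rw [abs_of_nonpos (by linarith)]
    linarith
  refine ⟨fun t => if t ≤ ℓ then γ t else η (t - ℓ), ?_, ?_, fun s t => ?_⟩
  · simp only [if_pos hℓ, h0]
  · dsimp only
    split_ifs with h
    · obtain rfl : m = 0 := by linarith
      rw [add_zero, h1, ← k0, k1]
    · rw [add_sub_cancel_left, k1]
  · dsimp only
    split_ifs with hs ht ht
    · exact h2 s t
    · exact key s t hs (not_le.1 ht)
    · rw [gasketDist_comm, abs_sub_comm]
      exact key t s ht (not_le.1 hs)
    · simpa using k2 (s - ℓ) (t - ℓ)

theorem gasketPoint_eq_iff {a b : ℕ → Fin 3} :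
    gasketPoint a = gasketPoint b ↔ codeMetric a b = 0 := by
  rw [codeMetric_eq_zero_iff, Subtype.ext_iff]
  rfl

theorem gasketPoint_consDigit_congr (i : Fin 3) {a b : ℕ → Fin 3}
    (h : gasketPoint a = gasketPoint b) :
    gasketPoint (consDigit i a) = gasketPoint (consDigit i b) := by
  rw [gasketPoint_eq_iff] at h ⊢
  rw [codeMetric_consDigit, h, zero_div]

theorem JoinedByLipschitz.consDigit {a b : ℕ → Fin 3} {ℓ : ℝ}
    (h : JoinedByLipschitz (gasketPoint a) (gasketPoint b) ℓ) (i : Fin 3) :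
    JoinedByLipschitz (gasketPoint (consDigit i a)) (gasketPoint (consDigit i b)) (ℓ / 2) := by
  obtain ⟨γ, h0, h1, h2⟩ := h
  refine ⟨fun t => gasketPoint (_root_.consDigit i
    (Function.surjInv gasketPoint_surjective (γ (2 * t)))), ?_, ?_, fun s t => ?_⟩
  · refine gasketPoint_consDigit_congr i ?_
    rw [mul_zero, h0, Function.surjInv_eq gasketPoint_surjective]
  · refine gasketPoint_consDigit_congr i ?_
    rw [mul_div_cancel₀ _ two_ne_zero, h1, Function.surjInv_eq gasketPoint_surjective]
  · rw [gasketDist_gasketPoint, codeMetric_consDigit]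
    have := h2 (2 * s) (2 * t)
    rw [← mul_sub, abs_mul, abs_two] at this
    unfold gasketDist at this
    linarith

/-- The curve `codeTowardsCorner`, started at time `0` and constant outside its interval. -/
theorem joinedByLipschitz_corner (a : ℕ → Fin 3) (j : Fin 3) :
    JoinedByLipschitz (gasketPoint a) (gasketPoint fun _ => j) (1 - bary a j) := by
  have hle := bary_le_one a j
  refine ⟨fun t => gasketPoint (codeTowardsCorner j a (Set.projIcc _ _ hle (bary a j + t))),
    ?_, ?_, fun s t => ?_⟩
  · rw [eq_comm, gasketPoint_eq_iff, add_zero, Set.projIcc_left]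
    refine le_antisymm ?_ (codeMetric_mem_Icc _ _).1
    simpa using codeMetric_codeTowardsCorner_start_le le_rfl hle
  · rw [gasketPoint_eq_iff, add_sub_cancel, Set.projIcc_right]
    refine le_antisymm ((codeMetric_le_corner _ _ j).trans_eq ?_) (codeMetric_mem_Icc _ _).1
    rw [bary_codeTowardsCorner hle le_rfl, bary_const, if_pos rfl]
    norm_num
  · rw [gasketDist_gasketPoint]
    wlog hst : s ≤ t generalizing s t
    · rw [codeMetric_comm, abs_sub_comm]
      exact this t s (le_of_not_ge hst)
    have h1 := Set.abs_projIcc_sub_projIcc hle (c := bary a j + s) (d := bary a j + t)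
    rw [add_sub_add_left_eq_sub] at h1
    refine le_trans ?_ h1
    rw [abs_sub_comm]
    refine le_trans ?_ (le_abs_self _)
    exact codeMetric_codeTowardsCorner_le (Set.projIcc _ _ hle _).2.1
      (Set.monotone_projIcc hle (by linarith)) (Set.projIcc _ _ hle _).2.2

theorem gasketPoint_consDigit_const (i j : Fin 3) :
    gasketPoint (consDigit i fun _ => j) = gasketPoint (consDigit j fun _ => i) :=
  Subtype.ext (codePoint_consDigit_const i j)

/-- The shorter of the two routes in `routeLength` is a curve: it consists of curves to corners of
cells and, for the route across the third cell, an edge of that cell. -/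
theorem joinedByLipschitz_of_ne {a b : ℕ → Fin 3} (h : a 0 ≠ b 0) :
    JoinedByLipschitz (gasketPoint a) (gasketPoint b) (codeMetric a b) := by
  have hc : ∀ (c : ℕ → Fin 3) (m : Fin 3),
      JoinedByLipschitz (gasketPoint c) (gasketPoint (consDigit (c 0) fun _ => m))
        ((1 - bary (dropDigits 1 c) m) / 2) := by
    intro c m
    have := (joinedByLipschitz_corner (dropDigits 1 c) m).consDigit (c 0)
    rwa [consDigit_dropDigits] at this
  have hn : ∀ (c : ℕ → Fin 3) (m : Fin 3), 0 ≤ (1 - bary c m) / 2 := fun c m => by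
    linarith [bary_le_one c m]
  rw [codeMetric_of_ne h, routeLength]
  rcases min_choice ((2 - bary (dropDigits 1 a) (b 0) - bary (dropDigits 1 b) (a 0)) / 2)
    ((1 + (bary (dropDigits 1 a) (a 0) + bary (dropDigits 1 a) (b 0)) +
      (bary (dropDigits 1 b) (a 0) + bary (dropDigits 1 b) (b 0))) / 2) with h' | h' <;> rw [h']
  · have h1 := hc a (b 0)
    have h2 := (hc b (a 0)).symm
    rw [gasketPoint_consDigit_const] at h2
    convert h1.trans (hn _ _) (hn _ _) h2 using 1
    ring
  · obtain ⟨l, -, -, hl⟩ := exists_bary_add_bary_eq h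
    have h1 := hc a l
    have h2 := hc (consDigit l fun _ => a 0) (b 0)
    have h3 := (hc b l).symm
    rw [consDigit_zero, dropDigits_consDigit, gasketPoint_consDigit_const l (a 0),
      gasketPoint_consDigit_const l (b 0)] at h2
    convert (h1.trans (hn _ _) (hn _ _) h2).trans (add_nonneg (hn _ _) (hn _ _)) (hn _ _) h3 using 1
    rw [hl, hl, bary_const, if_neg h]
    ring

/-- Any two points are joined by a geodesic. -/
theorem joinedByLipschitz (x y : gasket) : JoinedByLipschitz x y (gasketDist x y) := by
  obtain ⟨a, rfl⟩ := gasketPoint_surjective x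
  obtain ⟨b, rfl⟩ := gasketPoint_surjective y
  rw [gasketDist_gasketPoint]
  by_cases hab : a = b
  · rw [hab, codeMetric_self]
    exact ⟨fun _ => gasketPoint b, rfl, rfl, fun s t => by
      rw [gasketDist_self]
      exact abs_nonneg _⟩
  have key : ∀ (n : ℕ) (a b : ℕ → Fin 3), (∀ i < n, a i = b i) → a n ≠ b n →
      JoinedByLipschitz (gasketPoint a) (gasketPoint b) (codeMetric a b) := by
    intro n
    induction n with
    | zero => exact fun a b _ hne => joinedByLipschitz_of_ne hne
    | succ n ih =>
      intro a b h hne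
      have h0 := h 0 (by omega)
      have := (ih (dropDigits 1 a) (dropDigits 1 b) (agree_dropDigits h)
        (by rwa [dropDigits, dropDigits, add_comm])).consDigit (a 0)
      rwa [← codeMetric_of_eq h0, consDigit_dropDigits, h0, consDigit_dropDigits] at this
  exact key _ a b (fun i hi => PiNat.apply_eq_of_lt_firstDiff hi) (PiNat.apply_firstDiff_ne hab)

/-! ### Vertices and cells of level `n` -/

/-- The corners of the cells of level `n`: the points with a code that is constant from the digit
with index `n` on. -/
def vertices (n : ℕ) : Set gasket :=
  {v | ∃ a j, dropDigits n a = (fun _ => j) ∧ gasketPoint a = v}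

theorem vertices_finite (n : ℕ) : (vertices n).Finite := by
  refine (Set.finite_range fun p : Fin (n + 1) → Fin 3 =>
    gasketPoint fun i => p ⟨min i n, by omega⟩).subset ?_
  rintro _ ⟨a, j, ha, rfl⟩
  refine ⟨fun i => a i, congrArg gasketPoint (funext fun i => ?_)⟩
  have h1 := congrFun ha 0
  have h2 := congrFun ha (i - n)
  simp only [dropDigits, add_zero] at h1 h2
  rcases le_total i n with h | h
  · simp [min_eq_left h]
  · rw [Nat.add_sub_cancel' h] at h2
    simp [min_eq_right h, h1, h2]

/-- Two different cells of level `n` meet at most in a common corner. -/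
theorem dropDigits_eq_const_of_gasketPoint_eq {n : ℕ} {a b : ℕ → Fin 3}
    (h : gasketPoint a = gasketPoint b) (hab : ¬ ∀ i < n, a i = b i) :
    ∃ i j, dropDigits n a = (fun _ => i) ∧ dropDigits n b = fun _ => j := by
  have hne : a ≠ b := fun h => hab fun i _ => by rw [h]
  set k := PiNat.firstDiff a b with hk
  have hkn : k < n := by
    by_contra hkn
    exact hab fun i hi => PiNat.apply_eq_of_lt_firstDiff (by omega)
  obtain ⟨h1, h2⟩ := dropDigits_eq_const_of_codePoint_eq (n := k) (congrArg Subtype.val h)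
    (fun i hi => PiNat.apply_eq_of_lt_firstDiff hi) (PiNat.apply_firstDiff_ne hne)
  obtain ⟨m, rfl⟩ := Nat.exists_eq_add_of_lt hkn
  refine ⟨b k, a k, ?_, ?_⟩
  · rw [show k + m + 1 = k + 1 + m by omega, ← dropDigits_dropDigits, h1]
    rfl
  · rw [show k + m + 1 = k + 1 + m by omega, ← dropDigits_dropDigits, h2]
    rfl

theorem dropDigits_eq_const_of_mem_vertices {n : ℕ} {b : ℕ → Fin 3}
    (h : gasketPoint b ∈ vertices n) : ∃ j, dropDigits n b = fun _ => j := by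
  obtain ⟨a, j, ha, hab⟩ := h
  by_cases hn : ∀ i < n, a i = b i
  · refine ⟨j, eq_const_of_bary_eq_one ?_⟩
    have h1 : codeMetric a b = 0 := gasketPoint_eq_iff.1 hab
    rw [codeMetric_of_agree hn, ha, mul_eq_zero, or_iff_right (by positivity),
      codeMetric_eq_zero_iff, codePoint_eq_iff] at h1
    rw [← h1 j, bary_const, if_pos rfl]
  · obtain ⟨-, j', -, hj'⟩ := dropDigits_eq_const_of_gasketPoint_eq hab hn
    exact ⟨j', hj'⟩

/-- Two vertices of level `n` in the same cell are corners of that cell, hence equal or the ends of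
one of its sides. -/
theorem gasketDist_eq_dist_of_mem_vertices {n : ℕ} {a b : ℕ → Fin 3} (hn : ∀ i < n, a i = b i)
    (ha : gasketPoint a ∈ vertices n) (hb : gasketPoint b ∈ vertices n) :
    gasketDist (gasketPoint a) (gasketPoint b) = dist (gasketPoint a) (gasketPoint b) := by
  obtain ⟨i, hi⟩ := dropDigits_eq_const_of_mem_vertices ha
  obtain ⟨j, hj⟩ := dropDigits_eq_const_of_mem_vertices hb
  refine le_antisymm ?_ (dist_le_gasketDist _ _)
  change _ ≤ dist (codePoint a) (codePoint b)
  rw [gasketDist_gasketPoint, codeMetric_of_agree hn, dist_codePoint_of_agree hn, hi, hj]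
  refine mul_le_mul_of_nonneg_left ?_ (by positivity)
  by_cases hij : i = j
  · rw [hij, codeMetric_self, dist_self]
  · rw [dist_corner_corner hij]
    exact (codeMetric_mem_Icc _ _).2

theorem continuous_gasketPoint : Continuous gasketPoint :=
  continuous_codePoint.subtype_mk _

/-- A curve that meets no vertex of level `n`, except possibly at its ends, stays in one cell of
level `n`. -/
theorem exists_agree_of_forall_notMem_vertices {g : ℝ → gasket} (hg : Continuous g) {n : ℕ}
    {s t : ℝ} (hst : s < t) (h : ∀ u ∈ Set.Ioo s t, g u ∉ vertices n) :
    ∃ a b, (∀ i < n, a i = b i) ∧ gasketPoint a = g s ∧ gasketPoint b = g t := by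
  obtain ⟨u₀, hu₀⟩ := Set.nonempty_Ioo.2 hst
  obtain ⟨a₀, ha₀⟩ := gasketPoint_surjective (g u₀)
  have hclopen : IsClopen {b : ℕ → Fin 3 | ∀ i < n, b i = a₀ i} := by
    have : {b : ℕ → Fin 3 | ∀ i < n, b i = a₀ i} =
        ⋂ i ∈ Set.Iio n, (fun b : ℕ → Fin 3 => b i) ⁻¹' {a₀ i} := by
      ext b
      simp
    rw [this]
    exact (Set.finite_Iio n).isClopen_biInter fun i _ =>
      (isClopen_discrete _).preimage (continuous_apply i)
  -- The cell of `g u₀`, and the union of the other cells of level `n`.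
  set C := gasketPoint '' {b : ℕ → Fin 3 | ∀ i < n, b i = a₀ i} with hC
  set C' := gasketPoint '' {b : ℕ → Fin 3 | ∀ i < n, b i = a₀ i}ᶜ with hC'
  have hCc : IsClosed C := (hclopen.1.isCompact.image continuous_gasketPoint).isClosed
  have hCc' : IsClosed C' := (hclopen.compl.1.isCompact.image continuous_gasketPoint).isClosed
  have hsub : Set.Ioo s t ⊆ g ⁻¹' C := by
    by_contra hnot
    obtain ⟨u₁, hu₁, hu₁C⟩ := Set.not_subset.1 hnot
    have hcover : Set.Ioo s t ⊆ g ⁻¹' C ∪ g ⁻¹' C' := by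
      intro u _
      obtain ⟨b, hb⟩ := gasketPoint_surjective (g u)
      by_cases hbn : ∀ i < n, b i = a₀ i
      · exact Or.inl ⟨b, hbn, hb⟩
      · exact Or.inr ⟨b, hbn, hb⟩
    obtain ⟨u, hu, ⟨b, hb, hbu⟩, ⟨b', hb', hbu'⟩⟩ :=
      isPreconnected_closed_iff.1 isPreconnected_Ioo _ _ (hCc.preimage hg) (hCc'.preimage hg)
        hcover ⟨u₀, hu₀, a₀, fun _ _ => rfl, ha₀⟩
        ⟨u₁, hu₁, (hcover hu₁).resolve_left hu₁C⟩
    obtain ⟨i, -, hi, -⟩ := dropDigits_eq_const_of_gasketPoint_eq (n := n) (hbu.trans hbu'.symm)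
      fun hn => hb' fun i hi => (hn i hi).symm.trans (hb i hi)
    exact h u hu ⟨b, i, hi, hbu⟩
  have hcl : Set.Icc s t ⊆ g ⁻¹' C := by
    rw [← closure_Ioo hst.ne]
    exact closure_minimal hsub (hCc.preimage hg)
  obtain ⟨a, ha, has⟩ := hcl (Set.left_mem_Icc.2 hst.le)
  obtain ⟨b, hb, hbt⟩ := hcl (Set.right_mem_Icc.2 hst.le)
  exact ⟨a, b, fun i hi => (ha i hi).trans (hb i hi).symm, has, hbt⟩

theorem gasketDist_le_of_forall_notMem_vertices {g : ℝ → gasket} (hg : Continuous g) {n : ℕ}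
    {s t : ℝ} (hst : s ≤ t) (h : ∀ u ∈ Set.Ioo s t, g u ∉ vertices n) :
    gasketDist (g s) (g t) ≤ (1 / 2) ^ n := by
  rcases hst.eq_or_lt with rfl | hst
  · rw [gasketDist_self]
    positivity
  obtain ⟨a, b, hn, ha, hb⟩ := exists_agree_of_forall_notMem_vertices hg hst h
  rw [← ha, ← hb, gasketDist_gasketPoint]
  exact codeMetric_le_of_agree hn

/-! ### Curves are at least as long as the distance of their ends -/

/-- The increments of `v` dominate the chords of `g`; in the application `v` is the length of `g`
up to a given time. After its last visit to the vertex `g s`, the curve goes on to a next vertex,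
which is a vertex of the same cell, so that the distance of the two is a chord. The induction is
over the set `S` of vertices that the curve may still visit. -/
theorem gasketDist_le_of_mem_vertices {g : ℝ → gasket} (hg : Continuous g) {v : ℝ → ℝ}
    (hv : ∀ s t, s ≤ t → dist (g s) (g t) ≤ v t - v s) (n : ℕ) (T : ℝ) (S : Finset gasket)
    (s : ℝ) (hsT : s ≤ T) (hs : g s ∈ vertices n)
    (hS : ∀ u ∈ Set.Icc s T, g u ∈ vertices n → g u ∈ S) :
    gasketDist (g s) (g T) ≤ v T - v s + (1 / 2) ^ n := by
  classical
  induction S using Finset.strongInduction generalizing s with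
  | H S ih =>
  have hmono : ∀ s t, s ≤ t → v s ≤ v t := fun s t hst => by
    linarith [hv s t hst, dist_nonneg (x := g s) (y := g t)]
  -- The time `s'` of the last visit to the vertex `g s`.
  obtain ⟨s', ⟨⟨hss', hs'T⟩, hs'⟩, hlast⟩ :=
    (isCompact_Icc.inter_right (isClosed_singleton.preimage hg) :
      IsCompact (Set.Icc s T ∩ g ⁻¹' {g s})).exists_isGreatest ⟨s, ⟨le_rfl, hsT⟩, rfl⟩
  rw [Set.mem_preimage, Set.mem_singleton_iff] at hs'
  have hne : ∀ u, s' < u → u ≤ T → g u ≠ g s := fun u hu huT hgu =>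
    hu.not_ge (hlast ⟨⟨hss'.trans hu.le, huT⟩, hgu⟩)
  rw [← hs']
  by_cases hK : (Set.Icc s' T ∩ g ⁻¹' (vertices n \ {g s})).Nonempty
  · -- The time `u` of the next visit to a vertex.
    obtain ⟨u, ⟨⟨hs'u, huT⟩, hu, hus⟩, hfirst⟩ :=
      (isCompact_Icc.inter_right ((((vertices_finite n).subset Set.sdiff_subset).isClosed).preimage
        hg)).exists_isLeast hK
    have hs'u : s' < u := hs'u.lt_of_ne fun h => hus (h ▸ hs')
    obtain ⟨a, b, hab, ha, hb⟩ := exists_agree_of_forall_notMem_vertices hg hs'u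
      fun w hw hwn => hw.2.not_ge (hfirst ⟨⟨hw.1.le, hw.2.le.trans huT⟩, hwn,
        hne w hw.1 (hw.2.le.trans huT)⟩)
    have h1 : gasketDist (g s') (g u) ≤ v u - v s' := by
      rw [← ha, ← hb, gasketDist_eq_dist_of_mem_vertices hab (by rwa [ha, hs']) (by rwa [hb]),
        ha, hb]
      exact hv _ _ hs'u.le
    have h2 := ih (S.erase (g s)) (Finset.erase_ssubset (hS s ⟨le_rfl, hsT⟩ hs)) u huT hu
      fun w hw hwn => Finset.mem_erase.2 ⟨hne w (hs'u.trans_le hw.1) hw.2,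
        hS w ⟨hss'.trans (hs'u.le.trans hw.1), hw.2⟩ hwn⟩
    linarith [gasketDist_triangle (g s') (g u) (g T), hmono s s' hss']
  · have h1 := gasketDist_le_of_forall_notMem_vertices (n := n) hg hs'T fun w hw hwn =>
      hK ⟨w, ⟨hw.1.le, hw.2.le⟩, hwn, hne w hw.1 hw.2.le⟩
    linarith [hmono s T hsT]

/-- A function whose increments dominate the chords of a curve also dominates the distances of its
points: apply `gasketDist_le_of_mem_vertices` from the first visit to a vertex of level `n + 1`. -/
theorem gasketDist_le_of_dist_le {g : ℝ → gasket} (hg : Continuous g) {v : ℝ → ℝ}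
    (hv : ∀ s t, s ≤ t → dist (g s) (g t) ≤ v t - v s) {s t : ℝ} (hst : s ≤ t) :
    gasketDist (g s) (g t) ≤ v t - v s := by
  have hmono : ∀ s t, s ≤ t → v s ≤ v t := fun s t hst => by
    linarith [hv s t hst, dist_nonneg (x := g s) (y := g t)]
  refine le_of_forall_le_add_half_pow fun n => ?_
  have hpow : (1 / 2 : ℝ) ^ n = (1 / 2) ^ (n + 1) + (1 / 2) ^ (n + 1) := by
    rw [pow_succ]
    ring
  by_cases hK : (Set.Icc s t ∩ g ⁻¹' vertices (n + 1)).Nonempty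
  · obtain ⟨u, ⟨⟨hsu, hut⟩, hu⟩, hfirst⟩ :=
      (isCompact_Icc.inter_right ((vertices_finite (n + 1)).isClosed.preimage
        hg)).exists_isLeast hK
    have h1 := gasketDist_le_of_forall_notMem_vertices (n := n + 1) hg hsu fun w hw hwn =>
      hw.2.not_ge (hfirst ⟨⟨hw.1.le, hw.2.le.trans hut⟩, hwn⟩)
    have h2 := gasketDist_le_of_mem_vertices hg hv (n + 1) t (vertices_finite (n + 1)).toFinset u
      hut hu fun w _ hw => (vertices_finite (n + 1)).mem_toFinset.2 hw
    linarith [gasketDist_triangle (g s) (g u) (g t), hmono s u hsu]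
  · have h1 := gasketDist_le_of_forall_notMem_vertices (n := n + 1) hg hst fun w hw hwn =>
      hK ⟨w, ⟨hw.1.le, hw.2.le⟩, hwn⟩
    have : (0 : ℝ) ≤ (1 / 2) ^ (n + 1) := by positivity
    linarith [hmono s t hst]

theorem gasketDist_le_length {x y : gasket} (c : Path x y) (hc : eVariationOn c Set.univ ≠ ⊤) :
    gasketDist x y ≤ (eVariationOn c Set.univ).toReal := by
  have hle : eVariationOn c.extend Set.univ ≤ eVariationOn c Set.univ :=
    eVariationOn.comp_le_of_monotoneOn c (Set.projIcc 0 1 zero_le_one)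
      ((Set.monotone_projIcc _).monotoneOn _) (Set.mapsTo_univ _ _)
  have hbv : LocallyBoundedVariationOn c.extend Set.univ := fun a b _ _ =>
    ne_top_of_le_ne_top hc ((eVariationOn.mono _ Set.inter_subset_left).trans hle)
  have h := gasketDist_le_of_dist_le c.continuous_extend
    (v := variationOnFromTo c.extend Set.univ 0) (fun s t hst => ?_) zero_le_one
  · rw [c.extend_zero, c.extend_one, variationOnFromTo.self, sub_zero,
      variationOnFromTo.eq_of_le _ _ zero_le_one] at h
    exact h.trans (ENNReal.toReal_mono hc
      ((eVariationOn.mono _ Set.inter_subset_left).trans hle))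
  · rw [← variationOnFromTo.add hbv (Set.mem_univ 0) (Set.mem_univ s) (Set.mem_univ t),
      add_sub_cancel_left, variationOnFromTo.eq_of_le _ _ hst, dist_edist]
    exact ENNReal.toReal_mono (hbv s t trivial trivial)
      (eVariationOn.edist_le _ ⟨trivial, le_rfl, hst⟩ ⟨trivial, hst, le_rfl⟩)

/-! ### Shortest curves -/

theorem exists_path_eVariationOn_le {X : Type*} [MetricSpace X] {γ : ℝ → X}
    (hγ : LipschitzWith 1 γ) {ℓ : ℝ} (hℓ : 0 ≤ ℓ) :
    ∃ c : Path (γ 0) (γ ℓ), eVariationOn c Set.univ ≤ ENNReal.ofReal ℓ := by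
  have hcont : Continuous fun t : unitInterval => ℓ * (t : ℝ) :=
    continuous_const.mul continuous_subtype_val
  have hmono : MonotoneOn (fun t : unitInterval => ℓ * (t : ℝ)) Set.univ := fun s _ t _ hst =>
    mul_le_mul_of_nonneg_left hst hℓ
  refine ⟨⟨⟨fun t => γ (ℓ * t), hγ.continuous.comp hcont⟩, by simp, by simp⟩, ?_⟩
  have h1 := (hγ.lipschitzOnWith (s := Set.univ)).comp_eVariationOn_le
    (g := fun t : unitInterval => ℓ * (t : ℝ)) (s := Set.univ) (Set.mapsTo_univ _ _)
  have h2 := (hmono.eVariationOn_eq (Set.mem_univ 0) (Set.mem_univ 1)).le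
  rw [show Set.univ ∩ Set.Icc (0 : unitInterval) 1 = Set.univ from
    Set.eq_univ_of_forall fun t => ⟨trivial, t.2.1, t.2.2⟩] at h2
  simp only [ENNReal.coe_one, one_mul] at h1
  refine (h1.trans h2).trans_eq ?_
  simp

/-- A lower bound for the lengths of the curves from `x` to `y` is their minimum if some
`1`-Lipschitz curve gets from `x` to `y` in that time. -/
theorem isLeast_rectifiableLengths {X : Type*} [MetricSpace X] {x y : X} {ℓ : ℝ} (hℓ : 0 ≤ ℓ)
    {γ : ℝ → X} (hγ : ∀ s t, dist (γ s) (γ t) ≤ |s - t|) (h0 : γ 0 = x) (h1 : γ ℓ = y)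
    (hle : ∀ c : Path x y, eVariationOn c Set.univ ≠ ⊤ → ℓ ≤ (eVariationOn c Set.univ).toReal) :
    IsLeast (rectifiableLengths x y) ℓ := by
  subst h0 h1
  obtain ⟨c, hc⟩ := exists_path_eVariationOn_le (γ := γ)
    (LipschitzWith.of_dist_le_mul (K := 1) fun s t => by
      rw [NNReal.coe_one, one_mul]
      exact hγ s t) hℓ
  have hfin : eVariationOn c Set.univ ≠ ⊤ := ne_top_of_le_ne_top ENNReal.ofReal_ne_top hc
  refine ⟨⟨c, hfin, le_antisymm ?_ (hle c hfin)⟩, ?_⟩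
  · exact (ENNReal.toReal_mono ENNReal.ofReal_ne_top hc).trans_eq (ENNReal.toReal_ofReal hℓ)
  · rintro _ ⟨c', hfin', rfl⟩
    exact hle c' hfin'

theorem dist_le_toReal_eVariationOn {X : Type*} [MetricSpace X] {x y : X} (c : Path x y)
    (hc : eVariationOn c Set.univ ≠ ⊤) : dist x y ≤ (eVariationOn c Set.univ).toReal := by
  rw [dist_edist]
  refine ENNReal.toReal_mono hc ?_
  have := eVariationOn.edist_le c (Set.mem_univ 0) (Set.mem_univ 1)
  rwa [c.source, c.target] at this

theorem isLeast_gasketCurveLengths (x y : gasket) :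
    IsLeast (gasketCurveLengths x y) (gasketDist x y) := by
  obtain ⟨γ, h0, h1, hγ⟩ := joinedByLipschitz x y
  exact isLeast_rectifiableLengths (gasketDist_nonneg x y)
    (fun s t => (dist_le_gasketDist _ _).trans (hγ s t)) h0 h1 fun c => gasketDist_le_length c

theorem isStrictlyIntrinsic_gasketMetric : IsStrictlyIntrinsic gasketMetric := by
  intro x y
  obtain ⟨γ, h0, h1, hγ⟩ := joinedByLipschitz x y
  exact @isLeast_rectifiableLengths gasket gasketMetric x y _ (gasketDist_nonneg x y) γ hγ h0 h1
    fun c => @dist_le_toReal_eVariationOn gasket gasketMetric x y c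

theorem mainTheorem1 :
    (∀ x : gasket, ∃ a : ℕ → Fin 3, IsCode a x) ∧
    ∃ (d : gasket → gasket → ℝ) (m : MetricSpace gasket),
      IsCodeDistance d ∧
      (∀ x y : gasket, m.dist x y = d x y) ∧
      (∀ x y : gasket, IsLeast (gasketCurveLengths x y) (d x y)) ∧
      IsStrictlyIntrinsic m := by
  refine ⟨fun x => ?_, gasketDist, gasketMetric, isCodeDistance_gasketDist, fun _ _ => rfl,
    isLeast_gasketCurveLengths, isStrictlyIntrinsic_gasketMetric⟩
  obtain ⟨a, ha⟩ := gasketPoint_surjective x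
  exact ⟨a, (isCode_iff a x).2 ha⟩
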